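/- Let $k\ge 2$ be the number of actions. A learner, which knows a set $\mathcal H\subseteq\mathbb R^k$ and may randomise, sequentially queries actions $i\in[k]=\{1,\dots,k\}$ and after each query observes the reward $\mu_i$ of an unknown vector $\mu\in\mathcal H$ without noise; at some point it stops and outputs an action $\hat a\in[k]$ (and an estimate $\hat\mu\in\mathbb R^k$). For $\delta>0$, a learner is max-sound for $(\mathcal H,\delta)$ if, for every $\mu\in\mathcal H$, almost surely it stops and $\mu_{\hat a}>\max_a\mu_a-\delta$. Let $q(\mathscr A,\mu)\in[0,\infty]$ be the expected number of queries that the learner $\mathscr A$ executes when the reward vector is $\mu$, and let $$c_\delta^{\max}(\mathcal H)=\inf_{\mathscr A\text{ max-sound for }(\mathcal H,\delta)}\ \sup_{\mu\in\mathcal H} q(\mathscr A,\mu).$$ For $\Phi\in\mathbb R^{k\times d}$ and $\epsilon>0$ let $\mathcal H_\Phi^\epsilon=\{\Phi\theta:\theta\in\mathbb R^d\}+[-\epsilon,\epsilon]^k$. Proposition. For every $\epsilon>0$ and all integers $k\ge 2$ and $d\ge\lceil 8\log(k)/\epsilon^2\rceil$ there is a feature matrix $\Phi\in\mathbb R^{k\times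 d}$ such that $c_1^{\max}(\mathcal H_\Phi^\epsilon)\ge (k+1)/2$. That is, every learner that is max-sound for $(\mathcal H_\Phi^\epsilon,1)$ has worst-case expected number of queries $\sup_{\mu\in\mathcal H_\Phi^\epsilon}q(\mathscr A,\mu)$ at least $(k+1)/2$. -/

import Mathlib

open MeasureTheory
open scoped ENNReal Pointwise

namespace NearOptimal

/-- What a learner with `k` actions does next: `Sum.inl i` queries the action `i`, and
`Sum.inr (a, m)` stops with the estimated optimal action `a` and the estimated reward vector `m`. -/
abbrev Decision (k : ℕ) : Type := Fin k ⊕ (Fin k × (Fin k → ℝ))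

/-- A deterministic learner maps the list of all past queries and observed rewards
(most recent first) to its next decision. -/
abbrev DetLearner (k : ℕ) : Type := List (Fin k × ℝ) → Decision k

/-- The observations made by querying the actions in `l` when the reward vector is `μ`. -/
def observations {k : ℕ} (μ : Fin k → ℝ) (l : List (Fin k)) : List (Fin k × ℝ) :=
  l.map fun i => (i, μ i)

/-- The actions queried (most recent first, repetitions included) in the first `t` rounds of the
interaction of `π` with the reward vector `μ`. Nothing is queried any more once `π` has stopped. -/
def DetLearner.queried {k : ℕ} (π : DetLearner k) (μ : Fin k → ℝ) : ℕ → List (Fin k)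
  | 0 => []
  | t + 1 =>
    match π (observations μ (DetLearner.queried π μ t)) with
    | Sum.inl i => i :: DetLearner.queried π μ t
    | Sum.inr _ => DetLearner.queried π μ t

/-- The interaction of `π` with `μ` stops after finitely many rounds, with output `out`. -/
def DetLearner.Outputs {k : ℕ} (π : DetLearner k) (μ : Fin k → ℝ)
    (out : Fin k × (Fin k → ℝ)) : Prop :=
  ∃ t : ℕ, π (observations μ (π.queried μ t)) = Sum.inr out

/-- The total number of queries that `π` executes on `μ`; it is `∞` if `π` never stops. -/
noncomputable def DetLearner.numQueries {k : ℕ} (π : DetLearner k) (μ : Fin k → ℝ) : ℝ≥0∞ :=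
  ⨆ t : ℕ, ((π.queried μ t).length : ℝ≥0∞)

/-- A randomised learner: a deterministic learner that depends (measurably) on a random seed from
an arbitrary probability space. -/
structure Learner (k : ℕ) where
  /-- the space of random seeds -/
  Ω : Type
  /-- its events -/
  mΩ : MeasurableSpace Ω
  /-- the law of the seed -/
  law : @Measure Ω mΩ
  /-- the law is a probability measure -/
  isProb : @IsProbabilityMeasure Ω mΩ law
  /-- the decision for a given seed and a given list of past observations -/
  policy : Ω → DetLearner k
  /-- each decision is a random variable -/
  measurable_policy : ∀ h : List (Fin k × ℝ), @Measurable Ω (Decision k) mΩ _ fun ω => policy ω h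

attribute [instance] Learner.mΩ Learner.isProb

/-- The action `j` is `δ`-optimal for `μ`. -/
def IsOptimalWithin {k : ℕ} (δ : ℝ) (μ : Fin k → ℝ) (j : Fin k) : Prop :=
  (⨆ i, μ i) - δ < μ j

/-- `A` is max-sound for `(H, δ)`: for each `μ ∈ H` it almost surely stops and outputs a
`δ`-optimal action. -/
def Learner.MaxSound {k : ℕ} (A : Learner k) (H : Set (Fin k → ℝ)) (δ : ℝ) : Prop :=
  ∀ μ ∈ H, ∀ᵐ ω ∂A.law, ∃ out, (A.policy ω).Outputs μ out ∧ IsOptimalWithin δ μ out.1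

/-- The expected number of queries that `A` executes on `μ`. -/
noncomputable def Learner.expectedQueries {k : ℕ} (A : Learner k) (μ : Fin k → ℝ) : ℝ≥0∞ :=
  ∫⁻ ω, (A.policy ω).numQueries μ ∂A.law

/-- The minimax query complexity `c_δ^max(H)` of max-sound learners. -/
noncomputable def maxQueryComplexity {k : ℕ} (δ : ℝ) (H : Set (Fin k → ℝ)) : ℝ≥0∞ :=
  ⨅ (A : Learner k) (_ : A.MaxSound H δ), ⨆ μ ∈ H, A.expectedQueries μ

/-- The hypothesis class `Range(Φ) + [-ε, ε]^k`. -/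
def hypothesisClass {k d : ℕ} (Φ : Matrix (Fin k) (Fin d) ℝ) (ε : ℝ) : Set (Fin k → ℝ) :=
  Set.range (fun θ : Fin d → ℝ => Φ.mulVec θ) + {v | ∀ i, v i ∈ Set.Icc (-ε) ε}

end NearOptimal

/-! The class is made to contain every `± e_i`, which turns the problem into a search for a needle.
Geometry: `2 * k < exp (d * ε ^ 2 / 2)` allows `k` sign vectors in dimension `d` with pairwise inner
products at most `ε * d`. Taken as rows of `Φ`, they put every `c • e_i` with `|c| ≤ 1` within
sup-distance `ε` of the range (`exists_single_mem_hypothesisClass`). Search: on `e_i` only `i` is a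
valid answer, on `-e_i` it is invalid, and both look like `0` until `i` is queried. So for almost
every seed the run on `0` queries every action. The rounds of first queries are distinct, so the
costs on `e_1, …, e_k` sum to at least `1 + ⋯ + k`. Averaging over the seed and over `i` gives `(k +
1) / 2`, and the supremum dominates the average. -/

namespace NearOptimal

/-! ### Almost orthogonal sign vectors and the feature matrix -/

/-- Exponential moments of the inner product of a fixed sign vector with a random one. -/
lemma sum_sign_exp_le {d : ℕ} (c : ℝ) (t : Fin d → ℝ) (ht : ∀ x, t x ^ 2 = 1) :
    ∑ s ∈ Fintype.piFinset (fun _ : Fin d => ({1, -1} : Finset ℝ)),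
      Real.exp (c * ∑ x, s x * t x) ≤ 2 ^ d * Real.exp (d * (c ^ 2 / 2)) := by
  have h : ∀ s : Fin d → ℝ, Real.exp (c * ∑ x, s x * t x) = ∏ x, Real.exp (c * (s x * t x)) := by
    intro s
    rw [Finset.mul_sum, Real.exp_sum]
  simp_rw [h]
  rw [← Finset.prod_univ_sum (fun _ : Fin d => ({1, -1} : Finset ℝ))
    (fun x y => Real.exp (c * (y * t x)))]
  calc ∏ x, ∑ y ∈ ({1, -1} : Finset ℝ), Real.exp (c * (y * t x))
      ≤ ∏ _x : Fin d, (2 * Real.exp (c ^ 2 / 2)) := by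
        refine Finset.prod_le_prod (fun x _ => Finset.sum_nonneg fun y _ => (Real.exp_pos _).le)
          fun x _ => ?_
        rw [Finset.sum_pair (by norm_num)]
        have := Real.cosh_le_exp_half_sq (c * t x)
        rw [mul_pow, ht, mul_one, Real.cosh_eq] at this
        simp only [one_mul, neg_mul, mul_neg]
        linarith
    _ = 2 ^ d * Real.exp (d * (c ^ 2 / 2)) := by
        rw [Finset.prod_const, Finset.card_univ, Fintype.card_fin, mul_pow, ← Real.exp_nat_mul]

/-- A sign vector almost orthogonal to each of `n` given ones. -/
lemma exists_sign_almost_orthogonal {d n : ℕ} {ε : ℝ} (hε : 0 < ε)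
    (hn : 2 * (n : ℝ) < Real.exp (d * (ε ^ 2 / 2))) (t : Fin n → Fin d → ℝ)
    (ht : ∀ j x, t j x ^ 2 = 1) :
    ∃ s : Fin d → ℝ, (∀ x, s x ^ 2 = 1) ∧ ∀ j, |∑ x, s x * t j x| ≤ ε * d := by
  by_contra! hcon
  set S := Fintype.piFinset (fun _ : Fin d => ({1, -1} : Finset ℝ)) with hS
  have hcard : (S.card : ℝ) = 2 ^ d := by
    rw [hS, Fintype.card_piFinset_const, Finset.card_pair (by norm_num)]
    norm_num
  -- Chernoff and union bound by counting: if every sign vector were bad, summing this over all `2 ^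
  -- d` of them would give `exp (d * ε ^ 2) ≤ 2 * n * exp (d * ε ^ 2 / 2)`. The exponent parameter
  -- `ε` optimises the tail bound.
  have hlow : ∀ s ∈ S, Real.exp (ε * (ε * d)) ≤
      ∑ j, (Real.exp (ε * ∑ x, s x * t j x) + Real.exp (-ε * ∑ x, s x * t j x)) := by
    intro s hs
    have hs' : ∀ x, s x ^ 2 = 1 := by
      intro x
      have := Fintype.mem_piFinset.1 hs x
      simp only [Finset.mem_insert, Finset.mem_singleton] at this
      rcases this with h | h <;> simp [h]
    obtain ⟨j, hj⟩ := hcon s hs'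
    refine le_trans ?_ (Finset.single_le_sum (f := fun j =>
      Real.exp (ε * ∑ x, s x * t j x) + Real.exp (-ε * ∑ x, s x * t j x))
      (fun _ _ => by positivity) (Finset.mem_univ j))
    rcases lt_abs.1 hj with h | h
    · exact le_add_of_le_of_nonneg (Real.exp_le_exp.2 (by gcongr)) (Real.exp_pos _).le
    · refine le_add_of_nonneg_of_le (Real.exp_pos _).le (Real.exp_le_exp.2 ?_)
      rw [neg_mul, ← mul_neg]
      gcongr
  have hsum := Finset.sum_le_sum hlow
  rw [Finset.sum_const, nsmul_eq_mul, hcard, Finset.sum_comm] at hsum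
  have hup : ∑ j, ∑ s ∈ S, (Real.exp (ε * ∑ x, s x * t j x) + Real.exp (-ε * ∑ x, s x * t j x)) ≤
      ∑ _j : Fin n, 2 * (2 ^ d * Real.exp (d * (ε ^ 2 / 2))) := by
    refine Finset.sum_le_sum fun j _ => ?_
    rw [Finset.sum_add_distrib]
    have h1 := sum_sign_exp_le ε (t j) (ht j)
    have h2 := sum_sign_exp_le (-ε) (t j) (ht j)
    rw [neg_sq] at h2
    linarith
  rw [Finset.sum_const, Finset.card_univ, Fintype.card_fin, nsmul_eq_mul] at hup
  have hsq : Real.exp (ε * (ε * d)) =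
      Real.exp (d * (ε ^ 2 / 2)) * Real.exp (d * (ε ^ 2 / 2)) := by
    rw [← Real.exp_add]
    ring_nf
  rw [hsq] at hsum
  have hpos : (0 : ℝ) < 2 ^ d * Real.exp (d * (ε ^ 2 / 2)) := by positivity
  nlinarith [mul_lt_mul_of_pos_right hn hpos]

/-- Exponentially many pairwise almost orthogonal sign vectors. -/
lemma exists_almost_orthogonal_signs {d k : ℕ} {ε : ℝ} (hε : 0 < ε)
    (hk : 2 * (k : ℝ) < Real.exp (d * (ε ^ 2 / 2))) :
    ∃ t : Fin k → Fin d → ℝ, (∀ j x, t j x ^ 2 = 1) ∧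
      ∀ i j, i ≠ j → |∑ x, t i x * t j x| ≤ ε * d := by
  induction k with
  | zero => exact ⟨fun i => i.elim0, fun i => i.elim0, fun i => i.elim0⟩
  | succ n ih =>
    push_cast at hk
    obtain ⟨t, ht, hort⟩ := ih (by linarith)
    obtain ⟨s, hs, hst⟩ := exists_sign_almost_orthogonal hε (by linarith) t ht
    refine ⟨Fin.cons s t, fun j => Fin.cases (by simpa using hs) (by simpa using ht) j,
      fun i j => ?_⟩
    refine Fin.cases ?_ (fun i => ?_) i <;> refine Fin.cases ?_ (fun j => ?_) j
    · simp
    · intro _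
      simpa using hst j
    · intro _
      simpa [mul_comm] using hst i
    · intro hij
      simpa using hort i j (fun h => hij (by rw [h]))

/-- In logarithmic dimension some hypothesis class contains all the vectors `c • e_i`, `|c| ≤ 1`. -/
lemma exists_single_mem_hypothesisClass {k d : ℕ} (hk : 2 ≤ k) {ε : ℝ} (hε : 0 < ε)
    (hd : 8 * Real.log k / ε ^ 2 ≤ d) :
    ∃ Φ : Matrix (Fin k) (Fin d) ℝ, ∀ (i : Fin k) (c : ℝ), |c| ≤ 1 →
      Pi.single i c ∈ hypothesisClass Φ ε := by
  have hk' : (2 : ℝ) ≤ k := by exact_mod_cast hk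
  rcases le_or_gt 1 ε with h1 | h1
  · refine ⟨0, fun i c hc => Set.mem_add.2 ⟨0, ⟨0, by simp⟩, Pi.single i c, fun j => ?_, by simp⟩⟩
    rw [Set.mem_Icc, ← abs_le]
    rcases eq_or_ne j i with rfl | h
    · simpa using hc.trans h1
    · simpa [Pi.single_eq_of_ne h] using hε.le
  have hlog : 0 < Real.log k := Real.log_pos (by linarith)
  have hd0 : (0 : ℝ) < d := lt_of_lt_of_le (by positivity) hd
  -- The constant 8 makes the right side at least `k ^ 4`, hence at least `8 * k`.
  have hexp : 2 * (k : ℝ) < Real.exp (d * (ε ^ 2 / 2)) := by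
    rw [div_le_iff₀ (by positivity)] at hd
    calc 2 * (k : ℝ) < (k : ℝ) ^ 4 := by
          have : (8 : ℝ) ≤ (k : ℝ) ^ 3 := by
            calc (8 : ℝ) = 2 ^ 3 := by norm_num
              _ ≤ _ := by gcongr
          nlinarith
      _ = Real.exp (4 * Real.log k) := by
          rw [← Real.exp_log (show (0 : ℝ) < (k : ℝ) ^ 4 by positivity), Real.log_pow]
          norm_num
      _ ≤ _ := Real.exp_le_exp.2 (by linarith)
  obtain ⟨t, ht, hort⟩ := exists_almost_orthogonal_signs hε hexp
  -- Projecting onto row `i`, with squared norm `d`, gives exactly `c` at `i` and at most `ε` in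
  -- absolute value elsewhere; the box absorbs the difference.
  refine ⟨Matrix.of t, fun i c hc => Set.mem_add.2
    ⟨_, ⟨fun x => c / d * t i x, rfl⟩, Pi.single i c - (Matrix.of t).mulVec
      (fun x => c / d * t i x), fun j => ?_, by simp⟩⟩
  have hval : (Matrix.of t).mulVec (fun x => c / d * t i x) j = c / d * ∑ x, t i x * t j x := by
    simp only [Matrix.mulVec, dotProduct, Matrix.of_apply, Finset.mul_sum]
    exact Finset.sum_congr rfl fun x _ => by ring
  rw [Set.mem_Icc, ← abs_le, Pi.sub_apply, hval]
  rcases eq_or_ne i j with rfl | h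
  · have : ∑ x, t i x * t i x = (d : ℝ) := by
      simp [← pow_two, ht]
    rw [this, div_mul_cancel₀ _ hd0.ne']
    simpa using hε.le
  · rw [Pi.single_eq_of_ne h.symm, zero_sub, abs_neg, abs_mul, abs_div, abs_of_pos hd0]
    calc |c| / d * |∑ x, t i x * t j x| ≤ 1 / d * (ε * d) := by
          gcongr
          exact hort i j h
      _ = ε := by field_simp

/-! ### Transcripts of deterministic learners -/

section Interaction

variable {k : ℕ} (π : DetLearner k) {μ ν : Fin k → ℝ} {t : ℕ}

lemma observations_congr {l : List (Fin k)} (h : ∀ j ∈ l, μ j = ν j) :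
    observations μ l = observations ν l :=
  List.map_congr_left fun j hj => by rw [h j hj]

lemma DetLearner.queried_succ_of_inl {i : Fin k}
    (h : π (observations μ (π.queried μ t)) = Sum.inl i) :
    π.queried μ (t + 1) = i :: π.queried μ t := by
  simp [DetLearner.queried, h]

lemma DetLearner.queried_succ_of_inr {o : Fin k × (Fin k → ℝ)}
    (h : π (observations μ (π.queried μ t)) = Sum.inr o) :
    π.queried μ (t + 1) = π.queried μ t := by
  simp [DetLearner.queried, h]

lemma DetLearner.queried_subset_succ (t : ℕ) : π.queried μ t ⊆ π.queried μ (t + 1) := by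
  rcases h : π (observations μ (π.queried μ t)) with i | o
  · rw [π.queried_succ_of_inl h]
    exact List.subset_cons_self _ _
  · rw [π.queried_succ_of_inr h]
    exact List.Subset.refl _

/-- Reward vectors that agree on all queried actions give the same interaction. -/
lemma DetLearner.queried_congr (h : ∀ j ∈ π.queried μ t, μ j = ν j) :
    π.queried ν t = π.queried μ t := by
  induction t with
  | zero => rfl
  | succ t ih =>
    have ih := ih fun j hj => h j (π.queried_subset_succ t hj)
    have hobs := observations_congr fun j hj => h j (π.queried_subset_succ t hj)
    simp only [DetLearner.queried, ih, ← hobs]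

lemma DetLearner.stopped_of_le {o : Fin k × (Fin k → ℝ)} {s : ℕ} (hts : t ≤ s)
    (h : π (observations μ (π.queried μ t)) = Sum.inr o) :
    π (observations μ (π.queried μ s)) = Sum.inr o := by
  induction s, hts using Nat.le_induction with
  | base => exact h
  | succ s _ ih => rwa [π.queried_succ_of_inr ih]

lemma DetLearner.Outputs.unique {o o' : Fin k × (Fin k → ℝ)} (h : π.Outputs μ o)
    (h' : π.Outputs μ o') : o = o' := by
  obtain ⟨t, ht⟩ := h
  obtain ⟨t', ht'⟩ := h'
  exact Sum.inr_injective ((π.stopped_of_le (le_max_left t t') ht).symm.trans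
    (π.stopped_of_le (le_max_right t t') ht'))

lemma DetLearner.length_queried {i : Fin k}
    (h : π (observations μ (π.queried μ t)) = Sum.inl i) : (π.queried μ t).length = t := by
  induction t generalizing i with
  | zero => rfl
  | succ t ih =>
    rcases h' : π (observations μ (π.queried μ t)) with j | o
    · rw [π.queried_succ_of_inl h', List.length_cons, ih h']
    · rw [π.stopped_of_le (Nat.le_succ t) h'] at h
      cases h

end Interaction

/-! ### Cost of finding the needle -/

lemma one_le_iSup_single_one {k : ℕ} (i : Fin k) :
    1 ≤ ⨆ j, (Pi.single i (1 : ℝ) : Fin k → ℝ) j := by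
  simpa using le_ciSup (Set.finite_range (Pi.single i (1 : ℝ) : Fin k → ℝ)).bddAbove i

lemma eq_of_isOptimalWithin_single_one {k : ℕ} {i j : Fin k}
    (h : IsOptimalWithin 1 (Pi.single i (1 : ℝ)) j) : j = i := by
  by_contra hne
  have := one_le_iSup_single_one i
  rw [IsOptimalWithin, Pi.single_eq_of_ne hne] at h
  linarith

/-- As `k ≥ 2`, some other action has reward `0`, so `i` misses the maximum by at least `1`, which
the strict inequality excludes. -/
lemma ne_of_isOptimalWithin_single_neg_one {k : ℕ} (hk : 2 ≤ k) {i j : Fin k}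
    (h : IsOptimalWithin 1 (Pi.single i (-1 : ℝ)) j) : j ≠ i := by
  rintro rfl
  have : Nontrivial (Fin k) := Fin.nontrivial_iff_two_le.2 hk
  obtain ⟨m, hm⟩ := exists_ne j
  have hsup := le_ciSup (Set.finite_range (Pi.single j (-1 : ℝ) : Fin k → ℝ)).bddAbove m
  rw [Pi.single_eq_of_ne hm] at hsup
  rw [IsOptimalWithin, Pi.single_eq_same] at h
  linarith

/-- A learner that is correct on all the vectors `± e_i` queries every action if all rewards
are zero. -/
lemma DetLearner.exists_mem_queried_zero {k : ℕ} (hk : 2 ≤ k) (π : DetLearner k) (i : Fin k)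
    (hpos : ∃ out, π.Outputs (Pi.single i 1) out ∧ IsOptimalWithin 1 (Pi.single i 1) out.1)
    (hneg : ∃ out, π.Outputs (Pi.single i (-1)) out ∧
      IsOptimalWithin 1 (Pi.single i (-1)) out.1) :
    ∃ t, i ∈ π.queried 0 t := by
  by_contra! hcon
  obtain ⟨o, ⟨t, ht⟩, hopt⟩ := hpos
  obtain ⟨o', hout', hopt'⟩ := hneg
  have hagree : ∀ (c : ℝ), ∀ j ∈ π.queried 0 t, (0 : Fin k → ℝ) j = (Pi.single i c : Fin k → ℝ) j := by
    intro c j hj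
    have hji : j ≠ i := fun h => hcon t (h ▸ hj)
    rw [Pi.single_eq_of_ne hji]
    rfl
  -- With `i` unqueried, the run on `e_i` up to its stopping time is also the run on `0`, hence on
  -- `-e_i`.
  have hout : π.Outputs (Pi.single i (-1)) o := by
    refine ⟨t, ?_⟩
    rw [π.queried_congr (hagree _), ← observations_congr (hagree _)] at ht ⊢
    exact ht
  exact ne_of_isOptimalWithin_single_neg_one hk hopt'
    (hout'.unique π hout ▸ eq_of_isOptimalWithin_single_one hopt)

/-- The rounds in which new actions are queried are distinct, and finding the action `i` costs
at least as many queries as the round in which it is first queried. -/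
lemma DetLearner.exists_injective_le_numQueries {k : ℕ} (π : DetLearner k)
    (h : ∀ i, ∃ t, i ∈ π.queried 0 t) :
    ∃ T : Fin k → ℕ, Function.Injective T ∧
      ∀ (i : Fin k) (c : ℝ), ((T i + 1 : ℕ) : ℝ≥0∞) ≤ π.numQueries (Pi.single i c) := by
  -- Rounds are counted from zero: the decision after `t` rounds is the first query of `i`, hence
  -- query number `t + 1`.
  have key : ∀ i, ∃ t, i ∉ π.queried 0 t ∧
      π (observations 0 (π.queried 0 t)) = Sum.inl i := by
    classical
    intro i
    obtain ⟨t, ht⟩ : ∃ t, Nat.find (h i) = t + 1 := by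
      refine Nat.exists_eq_succ_of_ne_zero fun h0 => ?_
      have := Nat.find_spec (h i)
      rw [h0] at this
      simp [DetLearner.queried] at this
    have hnot : i ∉ π.queried 0 t := Nat.find_min (h i) (by omega)
    have hmem : i ∈ π.queried 0 (t + 1) := ht ▸ Nat.find_spec (h i)
    refine ⟨t, hnot, ?_⟩
    rcases h' : π (observations 0 (π.queried 0 t)) with j | o
    · rw [π.queried_succ_of_inl h', List.mem_cons] at hmem
      rw [hmem.resolve_right hnot]
    · rw [π.queried_succ_of_inr h'] at hmem
      exact absurd hmem hnot
  choose T hT hTi using key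
  refine ⟨T, fun i j hij => ?_, fun i c => ?_⟩
  · have := hTi i
    rw [hij, hTi j] at this
    exact (Sum.inl_injective this).symm
  · have hagree : ∀ j ∈ π.queried 0 (T i), (0 : Fin k → ℝ) j = (Pi.single i c : Fin k → ℝ) j := by
      intro j hj
      have hji : j ≠ i := fun h => hT i (h ▸ hj)
      rw [Pi.single_eq_of_ne hji]
      rfl
    have hq := π.queried_congr hagree
    have hdec : π (observations (Pi.single i c) (π.queried (Pi.single i c) (T i))) =
        Sum.inl i := by
      rw [hq, ← observations_congr hagree, hTi]
    refine le_trans (le_of_eq ?_) (le_iSup _ (T i + 1))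
    rw [π.queried_succ_of_inl hdec, List.length_cons, π.length_queried hdec]

lemma sum_range_le_sum_of_injective {k : ℕ} {T : Fin k → ℕ} (hT : Function.Injective T) :
    ∑ n ∈ Finset.range k, n ≤ ∑ i, T i := by
  have h := Finset.sum_range_le_sum
    (s := Finset.univ.map (⟨fun i => (T i : ℤ), Nat.cast_injective.comp hT⟩ : Fin k ↪ ℤ))
    (c := 0) (by simp)
  simp only [Finset.card_map, Finset.card_univ, Fintype.card_fin, zero_add, Finset.sum_map,
    Function.Embedding.coeFn_mk] at h
  zify
  exact h

/-- The total cost of finding each action. -/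
lemma DetLearner.le_sum_numQueries {k : ℕ} (π : DetLearner k)
    (h : ∀ i, ∃ t, i ∈ π.queried 0 t) :
    (k : ℝ≥0∞) * ((k + 1) / 2) ≤ ∑ i, π.numQueries (Pi.single i 1) := by
  obtain ⟨T, hinj, hT⟩ := π.exists_injective_le_numQueries h
  have hsum : k * (k + 1) ≤ 2 * ∑ i, (T i + 1) := by
    have h1 := sum_range_le_sum_of_injective hinj
    have h2 := Finset.sum_range_id_mul_two (k + 1)
    rw [Finset.sum_range_succ] at h2
    rw [Finset.sum_add_distrib]
    simp only [Finset.sum_const, Finset.card_univ, Fintype.card_fin, smul_eq_mul, mul_one]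
    simp only [Nat.add_sub_cancel] at h2
    nlinarith
  refine le_trans ?_ (Finset.sum_le_sum fun i _ => hT i 1)
  rw [← Nat.cast_sum, ← mul_div_assoc]
  refine ENNReal.div_le_of_le_mul' ?_
  exact_mod_cast hsum

/-! ### Measurability and averaging -/

/-- There are only countably many query lists, so conditioning on the previous list reduces each
round to the measurability of single decisions. -/
lemma Learner.measurableSet_queried_eq {k : ℕ} (A : Learner k) (μ : Fin k → ℝ) (t : ℕ)
    (l : List (Fin k)) : MeasurableSet {ω | (A.policy ω).queried μ t = l} := by
  induction t generalizing l with
  | zero => exact MeasurableSet.const ([] = l)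
  | succ t ih =>
    have hstep : ∀ l', MeasurableSet {ω | Sum.elim (fun i => i :: l') (fun _ => l')
        (A.policy ω (observations μ l')) = l} := by
      intro l'
      let _ : MeasurableSpace (List (Fin k)) := ⊤
      have hm : Measurable (Sum.elim (fun i => i :: l') (fun _ => l') :
          Decision k → List (Fin k)) :=
        Measurable.sumElim (measurable_of_finite _) measurable_const
      exact (hm.comp (A.measurable_policy _)) (MeasurableSpace.measurableSet_top (s := {l}))
    have hunion : {ω | (A.policy ω).queried μ (t + 1) = l} =
        ⋃ l', {ω | (A.policy ω).queried μ t = l'} ∩ {ω | Sum.elim (fun i => i :: l')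
          (fun _ => l') (A.policy ω (observations μ l')) = l} := by
      ext ω
      simp only [Set.mem_ofPred_eq, Set.mem_iUnion, Set.mem_inter_iff, exists_eq_left']
      rw [DetLearner.queried]
      cases A.policy ω (observations μ ((A.policy ω).queried μ t)) <;> rfl
    rw [hunion]
    exact MeasurableSet.iUnion fun l' => (ih l').inter (hstep l')

lemma Learner.measurable_numQueries {k : ℕ} (A : Learner k) (μ : Fin k → ℝ) :
    Measurable fun ω => (A.policy ω).numQueries μ := by
  let _ : MeasurableSpace (List (Fin k)) := ⊤
  refine Measurable.iSup fun t => ?_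
  have hq : Measurable fun ω => (A.policy ω).queried μ t :=
    measurable_to_countable' fun l => A.measurableSet_queried_eq μ t l
  exact (measurable_from_top (f := fun l : List (Fin k) => (l.length : ℝ≥0∞))).comp hq

/-- Finding a needle that is only recognised when queried takes `(k + 1) / 2` expected queries. -/
lemma le_maxQueryComplexity_of_single_mem {k : ℕ} (hk : 2 ≤ k) {H : Set (Fin k → ℝ)}
    (hpos : ∀ i, Pi.single i 1 ∈ H) (hneg : ∀ i, Pi.single i (-1) ∈ H) :
    ((k : ℝ≥0∞) + 1) / 2 ≤ maxQueryComplexity 1 H := by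
  refine le_iInf₂ fun A hA => ?_
  have hk0 : (k : ℝ≥0∞) ≠ 0 := by
    have : k ≠ 0 := by omega
    exact_mod_cast this
  have hae : ∀ᵐ ω ∂A.law, (k : ℝ≥0∞) * ((k + 1) / 2) ≤
      ∑ i, (A.policy ω).numQueries (Pi.single i 1) := by
    -- Only the finitely many vectors `± e_i` matter, so one null set of seeds serves for all of
    -- them.
    filter_upwards [ae_all_iff.2 fun i => hA _ (hpos i), ae_all_iff.2 fun i => hA _ (hneg i)]
      with ω h1 h2
    exact (A.policy ω).le_sum_numQueries fun i =>
      (A.policy ω).exists_mem_queried_zero hk i (h1 i) (h2 i)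
  have hint : (k : ℝ≥0∞) * ((k + 1) / 2) ≤ k * ⨆ μ ∈ H, A.expectedQueries μ := by
    calc (k : ℝ≥0∞) * ((k + 1) / 2) = ∫⁻ _, (k : ℝ≥0∞) * ((k + 1) / 2) ∂A.law := by simp
      _ ≤ ∫⁻ ω, ∑ i, (A.policy ω).numQueries (Pi.single i 1) ∂A.law := lintegral_mono_ae hae
      _ = ∑ i, A.expectedQueries (Pi.single i 1) :=
          lintegral_finsetSum _ fun i _ => A.measurable_numQueries _
      _ ≤ ∑ _i : Fin k, ⨆ μ ∈ H, A.expectedQueries μ :=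
          Finset.sum_le_sum fun i _ => le_iSup₂ (f := fun μ _ => A.expectedQueries μ) _ (hpos i)
      _ = k * ⨆ μ ∈ H, A.expectedQueries μ := by simp
  exact (ENNReal.mul_le_mul_iff_right hk0 (ENNReal.natCast_ne_top k)).1 hint

end NearOptimal

theorem proposition3p2 (k d : ℕ) (hk : 2 ≤ k) (ε : ℝ) (hε : 0 < ε)
    (hd : ⌈8 * Real.log (k : ℝ) / ε ^ 2⌉ ≤ (d : ℤ)) :
    ∃ Φ : Matrix (Fin k) (Fin d) ℝ,
      ((k : ℝ≥0∞) + 1) / 2 ≤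
        NearOptimal.maxQueryComplexity 1 (NearOptimal.hypothesisClass Φ ε) := by
  have hd' : 8 * Real.log k / ε ^ 2 ≤ d := by exact_mod_cast Int.ceil_le.1 hd
  obtain ⟨Φ, hΦ⟩ := NearOptimal.exists_single_mem_hypothesisClass hk hε hd'
  exact ⟨Φ, NearOptimal.le_maxQueryComplexity_of_single_mem hk (fun i => hΦ i 1 (by simp))
    fun i => hΦ i (-1) (by simp)⟩
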